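/- Let $\alpha>0$, $0<\beta\le 1$, $\eta>0$ and $t>0$. Let $$N(x,t)=\frac{1}{\alpha|x|}\,H^{2,1}_{3,3}\!\left[\frac{|x|}{(\eta t^\beta)^{1/\alpha}}\;\middle|\;{(1,\frac1\alpha),\,(1,\frac\beta\alpha),\,(1,\frac12)\atop (1,1),\,(1,\frac1\alpha),\,(1,\frac12)}\right],\qquad x\neq 0,$$ where, for $z>0$, the Fox function is the Mellin–Barnes integral $H(z)=\frac1{2\pi i}\int_{\gamma-i\infty}^{\gamma+i\infty}\Theta(\xi)\,z^{-\xi}\,d\xi$ with $$\Theta(\xi)=\frac{\Gamma(1+\xi)\,\Gamma(1+\xi/\alpha)\,\Gamma(-\xi/\alpha)}{\Gamma(-\xi/2)\,\Gamma(1+\beta\xi/\alpha)\,\Gamma(1+\xi/2)},$$ along any vertical line $\operatorname{Re}\xi=\gamma$ with the poles of $\Gamma(1+\xi)$ and $\Gamma(1+\xi/\alpha)$ on its left and those of $\Gamma(-\xi/\alpha)$ on its right. This integral converges absolutely for every $z>0$. For $\delta\in\mathbb C$ put $$\langle|x(t)|^\delta\rangle=\int_{-\infty}^{\infty}|x|^\delta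 N(x,t)\,dx .$$ Let $\operatorname{Re}\delta>-1$ and $\operatorname{Re}(\delta+\alpha)>0$, and suppose that $\operatorname{Re}\delta<\alpha$ or that $\alpha$ is an even integer. Then the integral converges absolutely and $$\langle|x(t)|^\delta\rangle=\frac2\alpha\,(\eta t^\beta)^{\delta/\alpha}\,\frac{\Gamma(-\frac\delta\alpha)\,\Gamma(1+\delta)\,\Gamma(1+\frac\delta\alpha)}{\Gamma(-\frac\delta2)\,\Gamma(1+\frac{\beta\delta}\alpha)\,\Gamma(1+\frac\delta2)},$$ where at the points $\delta=k\alpha$ ($k=0,1,2,\dots$) in this range, which are removable singularities, the right-hand side is understood as its limit. Moreover: (i) $\langle|x(t)|^\delta\rangle\to 1$ as $\delta\to0$, and the moment of order $0$ equals $1$; (ii) if $\alpha=2$, then $\langle|x(t)|^\delta\rangle\to\dfrac{2\eta t^\beta}{\Gamma(1+\beta)}$ as $\delta\to2$, and the moment of order $2$ equals this value. -/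

import Mathlib

open MeasureTheory Filter Topology

noncomputable section

/-- The Mellin-Barnes kernel `Θ(ξ)` of the Fox function `H^{m,n}_{p,q}`, with upper parameters
`(a_i, A_i)` and lower parameters `(b_j, B_j)`. Indices start at `0`, so the first `m` lower
parameters are those with `j < m` and the first `n` upper ones those with `i < n`. (A pole of
a Gamma function in the denominator makes the quotient `0`, as it should, because Mathlib gives
`Gamma` the value `0` there.) -/
def foxTheta (m n : ℕ) {p q : ℕ} (a : Fin p → ℂ × ℝ) (b : Fin q → ℂ × ℝ) (ξ : ℂ) : ℂ :=
  ((∏ j with j.val < m, Complex.Gamma ((b j).1 + (b j).2 * ξ)) *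
      ∏ i with i.val < n, Complex.Gamma (1 - (a i).1 - (a i).2 * ξ)) /
    ((∏ j with m ≤ j.val, Complex.Gamma (1 - (b j).1 - (b j).2 * ξ)) *
      ∏ i with n ≤ i.val, Complex.Gamma ((a i).1 + (a i).2 * ξ))

/-- The vertical line `Re ξ = γ` separates the poles `-(b_j + k) / B_j` of the factors
`Γ(b_j + B_j ξ)`, `j < m` (to its left), from the poles `(1 - a_i + k) / A_i` of the factors
`Γ(1 - a_i - A_i ξ)`, `i < n` (to its right). -/
def SeparatesPoles (γ : ℝ) (m n : ℕ) {p q : ℕ} (a : Fin p → ℂ × ℝ) (b : Fin q → ℂ × ℝ) : Prop :=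
  (∀ j : Fin q, j.val < m → ∀ k : ℕ, (-((b j).1 + k) / (b j).2).re < γ) ∧
  (∀ i : Fin p, i.val < n → ∀ k : ℕ, γ < ((1 - (a i).1 + k) / (a i).2).re)

/-- The integrand `τ ↦ Θ(γ + iτ) z^{-(γ + iτ)}` of the Mellin-Barnes integral on `Re ξ = γ`. -/
def foxIntegrand (γ : ℝ) (m n : ℕ) {p q : ℕ} (a : Fin p → ℂ × ℝ) (b : Fin q → ℂ × ℝ)
    (z : ℂ) (τ : ℝ) : ℂ :=
  foxTheta m n a b (γ + τ * Complex.I) * z ^ (-(γ + τ * Complex.I : ℂ))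

/-- The Fox function `H^{m,n}_{p,q}(z) = (1 / 2πi) ∫ Θ(ξ) z^{-ξ} dξ` along the upward vertical
line `ξ = γ + iτ`, on which `dξ = i dτ`. -/
def foxH (γ : ℝ) (m n : ℕ) {p q : ℕ} (a : Fin p → ℂ × ℝ) (b : Fin q → ℂ × ℝ) (z : ℂ) : ℂ :=
  1 / (2 * Real.pi * Complex.I) * (Complex.I * ∫ τ : ℝ, foxIntegrand γ m n a b z τ)

/-- Upper parameters of the fundamental solution. -/
def upperParams (α β : ℝ) : Fin 3 → ℂ × ℝ := ![(1, 1 / α), (1, β / α), (1, 1 / 2)]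

/-- Lower parameters of the fundamental solution. -/
def lowerParams (α : ℝ) : Fin 3 → ℂ × ℝ := ![(1, 1), (1, 1 / α), (1, 1 / 2)]

/-- The fundamental solution
`N(x,t) = 1 / (α |x|) * H^{2,1}_{3,3}[|x| / (η t^β)^{1/α}]`, the Fox function being taken along
`Re ξ = γ`. -/
def fundamentalSolution (γ α β η t x : ℝ) : ℂ :=
  1 / (α * |x| : ℝ) *
    foxH γ 2 1 (upperParams α β) (lowerParams α) ((|x| / (η * t ^ β) ^ (1 / α) : ℝ) : ℂ)

/-- The moment `⟨|x(t)|^δ⟩ = ∫ |x|^δ N(x,t) dx` over the whole real line, of complex order `δ`. -/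
def fractionalMoment (γ α β η t : ℝ) (δ : ℂ) : ℂ :=
  ∫ x : ℝ, ((|x| : ℝ) : ℂ) ^ δ * fundamentalSolution γ α β η t x

/-- The closed form of the moment of order `δ`. -/
def momentFormula (α β η t : ℝ) (δ : ℂ) : ℂ :=
  2 / α * ((η * t ^ β : ℝ) : ℂ) ^ (δ / α) *
    (Complex.Gamma (-δ / α) * Complex.Gamma (1 + δ) * Complex.Gamma (1 + δ / α)) /
    (Complex.Gamma (-δ / 2) * Complex.Gamma (1 + β * δ / α) * Complex.Gamma (1 + δ / 2))

/-- For the fundamental solution, the separating lines are those with `-min(1, α) < γ < 0`. -/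
theorem separatesPoles_iff (γ α β : ℝ) (hα : 0 < α) :
    SeparatesPoles γ 2 1 (upperParams α β) (lowerParams α) ↔ -1 < γ ∧ -α < γ ∧ γ < 0 := by
  have e0 : ∀ k : ℕ, (-((1 : ℂ) + k) / ((1 : ℝ) : ℂ)).re = -(1 + (k : ℝ)) := by
    intro k; rw [Complex.div_ofReal_re]; simp
  have e1 : ∀ k : ℕ, (-((1 : ℂ) + k) / ((1 / α : ℝ) : ℂ)).re = -(1 + (k : ℝ)) * α := by
    intro k; rw [Complex.div_ofReal_re]; simp
  have e2 : ∀ k : ℕ, ((1 - (1 : ℂ) + k) / ((1 / α : ℝ) : ℂ)).re = (k : ℝ) * α := by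
    intro k; rw [Complex.div_ofReal_re]; simp
  constructor
  · rintro ⟨h1, h2⟩
    have h10 := h1 0 (by decide) 0
    have h11 := h1 1 (by decide) 0
    have h20 := h2 0 (by decide) 0
    change (-((1 : ℂ) + (0 : ℕ)) / ((1 : ℝ) : ℂ)).re < γ at h10
    change (-((1 : ℂ) + (0 : ℕ)) / ((1 / α : ℝ) : ℂ)).re < γ at h11
    change γ < ((1 - (1 : ℂ) + (0 : ℕ)) / ((1 / α : ℝ) : ℂ)).re at h20
    rw [e0] at h10
    rw [e1] at h11
    rw [e2] at h20
    norm_num at h10 h11 h20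
    exact ⟨h10, h11, h20⟩
  · rintro ⟨h1, h2, h3⟩
    refine ⟨fun j hj k => ?_, fun i hi k => ?_⟩
    · have hk : (0 : ℝ) ≤ k := Nat.cast_nonneg k
      fin_cases j
      · change (-((1 : ℂ) + k) / ((1 : ℝ) : ℂ)).re < γ
        rw [e0]; linarith
      · change (-((1 : ℂ) + k) / ((1 / α : ℝ) : ℂ)).re < γ
        rw [e1]; nlinarith
      · exact absurd hj (by decide)
    · have hk : (0 : ℝ) ≤ k := Nat.cast_nonneg k
      fin_cases i
      · change γ < ((1 - (1 : ℂ) + k) / ((1 / α : ℝ) : ℂ)).re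
        rw [e2]; nlinarith
      · exact absurd hi (by decide)
      · exact absurd hi (by decide)

end

/-! On its line of integration the Fox function is the inverse Mellin transform of its kernel `Θ`.
Since `N` is even in `x`, its moment of order `δ` is, up to the factor `2/α` and a rescaling of
`|x|`, the Mellin transform of `H` at `δ`. Mellin inversion should therefore return `Θ(δ)`, and the
rescaling contributes `(η t^β)^(δ/α)`.

The difficulty is that the line `Re ξ = γ` lies to the left of `0`, while `Re δ` may lie to the
right of the points `kα`. The reflection formula settles this: it turns `Θ(ξ)` into
`Γ(1+ξ)/Γ(1+βξ/α) · sin(πξ/2)/sin(πξ/α)`. At `0` the zeros of the two sines cancel, and if `α` is an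
even integer the sine quotient is entire. So `Θ` extends holomorphically (`regularTheta`) to a strip
containing both `γ` and `Re δ`.

The extension decays exponentially on vertical lines (`IsSinQuotient.expDecayOnStrip`), so the
contour can be moved to `Re ξ = Re δ` (`ExpDecayOnStrip.mellinInv_eq`), where Mellin inversion
becomes Fourier inversion (`ExpDecayOnStrip.mellin_mellinInv`). The limits are values of the
extension, found by l'Hôpital's rule (`IsSinQuotient.mul_cos`). -/

/-! ### Exponential bounds for Gamma, its reciprocal and the sine in vertical strips. -/

/-- Horizontal lines can be exchanged in the integral of a holomorphic function that tends to `0`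
at the ends of the strip between them. -/
theorem integral_horizontal_eq_of_tendsto_zero {f : ℂ → ℂ} {a b : ℝ} {g : ℝ → ℝ}
    (hf : DifferentiableOn ℂ f {z | z.im ∈ Set.uIcc a b})
    (hfg : ∀ x : ℝ, ∀ y ∈ Set.uIcc a b, ‖f (x + y * Complex.I)‖ ≤ g x)
    (htop : Tendsto g atTop (𝓝 0)) (hbot : Tendsto g atBot (𝓝 0))
    (ha : Integrable fun x : ℝ => f (x + a * Complex.I))
    (hb : Integrable fun x : ℝ => f (x + b * Complex.I)) :
    ∫ x : ℝ, f (x + a * Complex.I) = ∫ x : ℝ, f (x + b * Complex.I) := by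
  have vert : ∀ x : ℝ, ‖∫ y in a..b, f (x + y * Complex.I)‖ ≤ g x * |b - a| := fun x =>
    intervalIntegral.norm_integral_le_of_norm_le_const fun y hy =>
      hfg x y (Set.uIoc_subset_uIcc hy)
  have hv : ∀ {l : Filter ℝ} {u : ℝ → ℝ}, Tendsto (g ∘ u) l (𝓝 0) →
      Tendsto (fun T => ∫ y in a..b, f (u T + y * Complex.I)) l (𝓝 0) := fun h =>
    squeeze_zero_norm (fun T => vert _) (by simpa using h.mul_const |b - a|)
  have h1 := hv (u := id) htop
  have h2 := hv (u := fun T => -T) (hbot.comp tendsto_neg_atTop_atBot)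
  have ia := intervalIntegral_tendsto_integral ha tendsto_neg_atTop_atBot tendsto_id
  have ib := intervalIntegral_tendsto_integral hb tendsto_neg_atTop_atBot tendsto_id
  have rect : ∀ T : ℝ, (∫ x in (-T)..id T, f (x + a * Complex.I)) -
      (∫ x in (-T)..id T, f (x + b * Complex.I)) +
      Complex.I • (∫ y in a..b, f ((id T : ℝ) + y * Complex.I)) -
      Complex.I • (∫ y in a..b, f ((-T : ℝ) + y * Complex.I)) = 0 := by
    intro T
    have := Complex.integral_boundary_rect_eq_zero_of_differentiableOn f
      (⟨-T, a⟩ : ℂ) (⟨T, b⟩ : ℂ) (hf.mono fun z hz => hz.2)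
    simpa using this
  have lim := ((ia.sub ib).add (h1.const_smul Complex.I)).sub (h2.const_smul Complex.I)
  have h0 := tendsto_nhds_unique (lim.congr rect) tendsto_const_nhds
  simpa [sub_eq_zero] using h0

theorem integral_Ioi_eq_integral_exp (f : ℝ → ℂ) :
    ∫ x in Set.Ioi (0 : ℝ), f x = ∫ u : ℝ, (Real.exp u : ℂ) * f (Real.exp u) := by
  have := integral_image_eq_integral_abs_deriv_smul (f := Real.exp) (f' := Real.exp)
    (s := Set.univ) MeasurableSet.univ (fun x _ => (Real.hasDerivAt_exp x).hasDerivWithinAt)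
    Real.exp_injective.injOn f
  rw [Set.image_univ, Real.range_exp] at this
  simpa [abs_of_pos, Real.exp_pos] using this

theorem integrable_exp_mul_exp_neg_mul_exp {σ c : ℝ} (hσ : 0 < σ) (hc : 0 < c) :
    Integrable fun u : ℝ => Real.exp (σ * u) * Real.exp (-(c * Real.exp u)) := by
  have h := integrableOn_rpow_mul_exp_neg_mul_rpow (p := 1) (s := σ - 1) (b := c) (by linarith)
    one_pos hc
  have := integrableOn_image_iff_integrableOn_abs_deriv_smul (f := Real.exp) (f' := Real.exp)
    (s := Set.univ) MeasurableSet.univ (fun x _ => (Real.hasDerivAt_exp x).hasDerivWithinAt)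
    Real.exp_injective.injOn (fun x : ℝ => x ^ (σ - 1) * Real.exp (-c * x ^ (1 : ℝ)))
  rw [Set.image_univ, Real.range_exp] at this
  refine (integrableOn_univ.1 (this.1 h)).congr (Eventually.of_forall fun u => ?_)
  simp only [abs_of_pos (Real.exp_pos u), smul_eq_mul, Real.rpow_one, ← Real.exp_mul,
    ← Real.exp_add]
  congr 1; ring

theorem tendsto_exp_mul_exp_neg_mul_exp_atTop {σ c : ℝ} (hc : 0 < c) :
    Tendsto (fun u : ℝ => Real.exp (σ * u) * Real.exp (-(c * Real.exp u))) atTop (𝓝 0) := by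
  refine ((tendsto_rpow_mul_exp_neg_mul_atTop_nhds_zero σ c hc).comp
    Real.tendsto_exp_atTop).congr fun u => ?_
  simp [← Real.exp_mul, mul_comm]

theorem tendsto_exp_mul_exp_neg_mul_exp_atBot {σ c : ℝ} (hσ : 0 < σ) (hc : 0 < c) :
    Tendsto (fun u : ℝ => Real.exp (σ * u) * Real.exp (-(c * Real.exp u))) atBot (𝓝 0) := by
  refine squeeze_zero (fun u => by positivity) (fun u => ?_)
    (Real.tendsto_exp_atBot.comp (tendsto_id.const_mul_atBot hσ))
  refine mul_le_of_le_one_right (Real.exp_pos _).le (Real.exp_le_one_iff.2 ?_)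
  have := mul_pos hc (Real.exp_pos u)
  linarith

theorem Complex.Gamma_eq_integral_exp {s : ℂ} (hs : 0 < s.re) :
    Complex.Gamma s = ∫ u : ℝ, Complex.exp (s * u - Complex.exp u) := by
  rw [Complex.Gamma_eq_integral hs, Complex.GammaIntegral, integral_Ioi_eq_integral_exp]
  congr 1; ext u
  rw [Complex.ofReal_exp, Complex.cpow_def_of_ne_zero (Complex.exp_ne_zero _),
    ← Complex.ofReal_exp u, ← Complex.ofReal_log (Real.exp_pos u).le, Real.log_exp,
    Complex.ofReal_exp, Complex.ofReal_exp, ← Complex.exp_add, ← Complex.exp_add]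
  congr 1; push_cast; ring

theorem norm_exp_mul_sub_exp (s : ℂ) (x y : ℝ) :
    ‖Complex.exp (s * (x + y * Complex.I) - Complex.exp (x + y * Complex.I))‖ =
      Real.exp (-(s.im * y)) * (Real.exp (s.re * x) * Real.exp (-(Real.cos y * Real.exp x))) := by
  rw [Complex.norm_exp, ← Real.exp_add, ← Real.exp_add]
  congr 1
  simp [Complex.exp_re]
  ring

/-- The integral of Euler can be taken along any ray in the right half plane. -/
theorem Complex.Gamma_eq_integral_exp_rotated {s : ℂ} (hs : 0 < s.re) {θ : ℝ}
    (hθ : |θ| < Real.pi / 2) :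
    Complex.Gamma s = ∫ u : ℝ,
      Complex.exp (s * (u + θ * Complex.I) - Complex.exp (u + θ * Complex.I)) := by
  have hcos : ∀ y ∈ Set.uIcc 0 θ, Real.cos θ ≤ Real.cos y := by
    intro y hy
    have hy' : |y| ≤ |θ| := by simpa using Set.abs_sub_left_of_mem_uIcc hy
    rw [← Real.cos_abs θ, ← Real.cos_abs y]
    exact Real.cos_le_cos_of_nonneg_of_le_pi (abs_nonneg _) (by linarith [Real.pi_pos]) hy'
  have hc : 0 < Real.cos θ := Real.cos_pos_of_mem_Ioo (abs_lt.1 hθ)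
  have hint : ∀ y ∈ Set.uIcc 0 θ, Integrable fun u : ℝ =>
      Complex.exp (s * (u + y * Complex.I) - Complex.exp (u + y * Complex.I)) := by
    intro y hy
    refine ((integrable_exp_mul_exp_neg_mul_exp hs (hc.trans_le (hcos y hy))).const_mul
      (Real.exp (-(s.im * y)))).mono' (by fun_prop) (Eventually.of_forall fun x => ?_)
    rw [norm_exp_mul_sub_exp]
  rw [Complex.Gamma_eq_integral_exp hs]
  have := integral_horizontal_eq_of_tendsto_zero (a := 0) (b := θ)
    (f := fun z => Complex.exp (s * z - Complex.exp z))
    (g := fun x => Real.exp (|s.im| * |θ|) *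
      (Real.exp (s.re * x) * Real.exp (-(Real.cos θ * Real.exp x))))
    (by fun_prop) ?_ ?_ ?_ (hint 0 Set.left_mem_uIcc) (hint θ Set.right_mem_uIcc)
  · simpa using this
  · intro x y hy
    rw [norm_exp_mul_sub_exp]
    have hy' : |y| ≤ |θ| := by simpa using Set.abs_sub_left_of_mem_uIcc hy
    have h1 : -(s.im * y) ≤ |s.im| * |θ| := (neg_le_abs _).trans (by rw [abs_mul]; gcongr)
    have := hcos y hy
    gcongr
  · simpa using (tendsto_exp_mul_exp_neg_mul_exp_atTop hc).const_mul _
  · simpa using (tendsto_exp_mul_exp_neg_mul_exp_atBot hs hc).const_mul _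

/-- Turning the ray in Euler's integral by `±θ`, with the sign of `Im s`, extracts the factor
`exp(-θ|Im s|)`. Every rate below `π/2` is reached in this way without Stirling's formula. -/
theorem Complex.exists_norm_Gamma_le {c d θ : ℝ} (hc : 0 < c) (hθ0 : 0 ≤ θ)
    (hθ : θ < Real.pi / 2) :
    ∃ C, 0 ≤ C ∧ ∀ s : ℂ, c ≤ s.re → s.re ≤ d →
      ‖Complex.Gamma s‖ ≤ C * Real.exp (-(θ * |s.im|)) := by
  let J : ℝ → ℝ → ℝ := fun σ u => Real.exp (σ * u) * Real.exp (-(Real.cos θ * Real.exp u))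
  have hcos : 0 < Real.cos θ := Real.cos_pos_of_mem_Ioo ⟨by linarith, hθ⟩
  have hJ : ∀ σ, 0 < σ → Integrable (J σ) := fun σ hσ =>
    integrable_exp_mul_exp_neg_mul_exp hσ hcos
  -- The two terms dominate `exp(u Re s)` for `u ≤ 0` and `u ≥ 0` respectively. The maximum keeps
  -- the second exponent positive even when `d < c`.
  refine ⟨∫ u, (J c u + J (max c d) u), integral_nonneg fun u => by positivity,
    fun s hs hs' => ?_⟩
  have key : ∀ θ' : ℝ, |θ'| = θ → θ' * s.im = θ * |s.im| →
      ‖Complex.Gamma s‖ ≤ (∫ u, (J c u + J (max c d) u)) * Real.exp (-(θ * |s.im|)) := by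
    intro θ' h1 h2
    rw [Complex.Gamma_eq_integral_exp_rotated (hc.trans_le hs) (h1.symm ▸ hθ),
      ← integral_mul_const]
    refine norm_integral_le_of_norm_le
      (((hJ c hc).add (hJ _ (hc.trans_le (le_max_left c d)))).mul_const _)
      (Eventually.of_forall fun u => ?_)
    rw [norm_exp_mul_sub_exp, mul_comm s.im, h2, ← Real.cos_abs θ', h1, mul_comm]
    refine mul_le_mul_of_nonneg_right ?_ (Real.exp_pos _).le
    simp only [J, ← add_mul]
    refine mul_le_mul_of_nonneg_right ?_ (Real.exp_pos _).le
    rcases le_total 0 u with hu | hu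
    · exact le_add_of_nonneg_of_le (Real.exp_pos _).le (Real.exp_le_exp.2
        (mul_le_mul_of_nonneg_right (hs'.trans (le_max_right _ _)) hu))
    · exact le_add_of_le_of_nonneg (Real.exp_le_exp.2
        (mul_le_mul_of_nonpos_right hs hu)) (Real.exp_pos _).le
  rcases le_total 0 s.im with h | h
  · exact key θ (abs_of_nonneg hθ0) (by rw [abs_of_nonneg h])
  · exact key (-θ) (by rw [abs_neg, abs_of_nonneg hθ0]) (by rw [abs_of_nonpos h]; ring)

theorem Complex.norm_sin_le_exp (z : ℂ) : ‖Complex.sin z‖ ≤ Real.exp |z.im| := by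
  have h1 : ‖Complex.exp (-z * Complex.I)‖ ≤ Real.exp |z.im| := by
    rw [Complex.norm_exp]; exact Real.exp_le_exp.2 (by simpa using le_abs_self z.im)
  have h2 : ‖Complex.exp (z * Complex.I)‖ ≤ Real.exp |z.im| := by
    rw [Complex.norm_exp]; exact Real.exp_le_exp.2 (by simpa using neg_le_abs z.im)
  have h3 := norm_sub_le (Complex.exp (-z * Complex.I)) (Complex.exp (z * Complex.I))
  rw [Complex.sin, norm_div, norm_mul, Complex.norm_I, Complex.norm_ofNat]
  linarith

theorem Complex.exp_sub_exp_div_two_le_norm_sin (z : ℂ) :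
    (Real.exp |z.im| - Real.exp (-|z.im|)) / 2 ≤ ‖Complex.sin z‖ := by
  have h1 : ‖Complex.exp (-z * Complex.I)‖ = Real.exp z.im := by
    rw [Complex.norm_exp]; simp
  have h2 : ‖Complex.exp (z * Complex.I)‖ = Real.exp (-z.im) := by
    rw [Complex.norm_exp]; simp
  have h3 := abs_norm_sub_norm_le (Complex.exp (-z * Complex.I)) (Complex.exp (z * Complex.I))
  rw [h1, h2] at h3
  rw [Complex.sin, norm_div, norm_mul, Complex.norm_I, Complex.norm_ofNat]
  have h4 : Real.exp |z.im| - Real.exp (-|z.im|) ≤ |Real.exp z.im - Real.exp (-z.im)| := by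
    rcases le_total 0 z.im with h | h
    · rw [abs_of_nonneg h]; exact le_abs_self _
    · rw [abs_of_nonpos h, neg_neg, abs_sub_comm]; exact le_abs_self _
  linarith

theorem Complex.exists_norm_inv_sin_le {y : ℝ} (hy : 0 < y) :
    ∃ C, 0 ≤ C ∧ ∀ z : ℂ, y ≤ |z.im| → ‖(Complex.sin z)⁻¹‖ ≤ C * Real.exp (-|z.im|) := by
  have hy' : 0 < 1 - Real.exp (-(2 * y)) := by
    have : Real.exp (-(2 * y)) < 1 := Real.exp_lt_one_iff.2 (by linarith)
    linarith
  refine ⟨2 / (1 - Real.exp (-(2 * y))), by positivity, fun z hz => ?_⟩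
  have h1 := Complex.exp_sub_exp_div_two_le_norm_sin z
  have h2 : (1 - Real.exp (-(2 * y))) / 2 * Real.exp |z.im| ≤ ‖Complex.sin z‖ := by
    refine le_trans ?_ h1
    have : Real.exp (-|z.im|) ≤ Real.exp (-(2 * y)) * Real.exp |z.im| := by
      rw [← Real.exp_add]; exact Real.exp_le_exp.2 (by linarith)
    linarith
  rw [norm_inv]
  calc ‖Complex.sin z‖⁻¹ ≤ ((1 - Real.exp (-(2 * y))) / 2 * Real.exp |z.im|)⁻¹ := by gcongr
    _ = _ := by rw [mul_inv, inv_div, Real.exp_neg |z.im|]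

theorem Complex.inv_Gamma_eq_Gamma_one_sub_mul_sin (s : ℂ) (hs : Complex.sin (Real.pi * s) ≠ 0) :
    (Complex.Gamma s)⁻¹ = Complex.Gamma (1 - s) * Complex.sin (Real.pi * s) / Real.pi := by
  have h := Complex.Gamma_mul_Gamma_one_sub s
  have hpi : (Real.pi : ℂ) ≠ 0 := Complex.ofReal_ne_zero.2 Real.pi_ne_zero
  have h0 : Complex.Gamma s ≠ 0 := fun h0 => by
    rw [h0, zero_mul, eq_comm, div_eq_zero_iff] at h
    tauto
  rw [eq_div_iff hs] at h
  rw [eq_div_iff hpi, inv_mul_eq_iff_eq_mul₀ h0]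
  linear_combination -h

/-- For `Re s ≤ 1/2` the reflection formula writes `1/Γ(s)` as `Γ(1-s) sin(πs)/π`, of growth rate `π
- θ`. The recursion `Γ(s) = (s-1)Γ(s-1)` then extends the bound to the right one unit at a time. The
distance `y` from the real axis keeps `sin(πs)` nonzero and bounds `1/|s-1|` by `1/y`. -/
theorem Complex.exists_norm_inv_Gamma_le {y θ : ℝ} (hy : 0 < y) (hθ0 : 0 ≤ θ)
    (hθ : θ < Real.pi / 2) (c d : ℝ) :
    ∃ C, 0 ≤ C ∧ ∀ s : ℂ, c ≤ s.re → s.re ≤ d → y ≤ |s.im| →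
      ‖(Complex.Gamma s)⁻¹‖ ≤ C * Real.exp ((Real.pi - θ) * |s.im|) := by
  have key : ∀ (n : ℕ) (c : ℝ), ∃ C, 0 ≤ C ∧ ∀ s : ℂ, c ≤ s.re → s.re ≤ 1 / 2 + n →
      y ≤ |s.im| → ‖(Complex.Gamma s)⁻¹‖ ≤ C * Real.exp ((Real.pi - θ) * |s.im|) := by
    intro n
    induction n with
    | zero =>
      intro c
      obtain ⟨C, hC, h⟩ := Complex.exists_norm_Gamma_le (c := 1 / 2) (d := 1 - c) (by norm_num)
        hθ0 hθ
      refine ⟨C / Real.pi, by positivity, fun s h1 h2 h3 => ?_⟩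
      have him : ((Real.pi : ℂ) * s).im = Real.pi * s.im := by simp
      have hsin : Complex.sin (Real.pi * s) ≠ 0 := by
        refine norm_pos_iff.1 (lt_of_lt_of_le ?_
          (Complex.exp_sub_exp_div_two_le_norm_sin (Real.pi * s)))
        have : 0 < |((Real.pi : ℂ) * s).im| := by
          rw [him, abs_mul, abs_of_pos Real.pi_pos]
          exact mul_pos Real.pi_pos (hy.trans_le h3)
        have := Real.exp_lt_exp.2 (neg_lt_self this)
        linarith
      rw [Complex.inv_Gamma_eq_Gamma_one_sub_mul_sin s hsin, norm_div, norm_mul,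
        Complex.norm_of_nonneg Real.pi_pos.le]
      have hG := h (1 - s) (by norm_num at h2 ⊢; linarith) (by simp; linarith)
      have hS := Complex.norm_sin_le_exp (Real.pi * s)
      rw [him, abs_mul, abs_of_pos Real.pi_pos] at hS
      have him' : |(1 - s).im| = |s.im| := by simp
      rw [him'] at hG
      calc _ ≤ (C * Real.exp (-(θ * |s.im|))) * Real.exp (Real.pi * |s.im|) / Real.pi := by gcongr
        _ = _ := by
          rw [mul_assoc, ← Real.exp_add, mul_div_right_comm]
          congr 2; ring
    | succ n ih =>
      intro c
      obtain ⟨C, hC, h⟩ := ih (c - 1)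
      refine ⟨y⁻¹ * C, by positivity, fun s h1 h2 h3 => ?_⟩
      have him : (s - 1).im = s.im := by simp
      have hn : y ≤ ‖s - 1‖ := h3.trans (him ▸ Complex.abs_im_le_norm (s - 1))
      have h0 : s - 1 ≠ 0 := norm_pos_iff.1 (hy.trans_le hn)
      have hG := Complex.Gamma_add_one _ h0
      rw [sub_add_cancel] at hG
      rw [hG, mul_inv, norm_mul, norm_inv, mul_assoc]
      have := h (s - 1) (by simpa using h1) (by push_cast at h2; simp; linarith) (him ▸ h3)
      rw [him] at this
      gcongr
  obtain ⟨n, hn⟩ := exists_nat_ge d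
  obtain ⟨C, hC, h⟩ := key n c
  exact ⟨C, hC, fun s h1 h2 h3 => h s h1 (by linarith) h3⟩

/-! ### Mellin inversion for functions decaying exponentially on a strip. -/

/-- `F` is holomorphic on the open strip `a < Re ξ < b` and decays exponentially along vertical
lines, uniformly on closed substrips. -/
structure ExpDecayOnStrip (F : ℂ → ℂ) (a b κ : ℝ) : Prop where
  pos : 0 < κ
  differentiableOn : DifferentiableOn ℂ F {ξ | a < ξ.re ∧ ξ.re < b}
  exists_norm_le : ∀ c d : ℝ, a < c → d < b → ∃ C, ∀ ξ : ℂ, c ≤ ξ.re → ξ.re ≤ d →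
    ‖F ξ‖ ≤ C * Real.exp (-(κ * |ξ.im|))

theorem MeasureTheory.IntegrableOn.integrable_comp_abs {E : Type*} [NormedAddCommGroup E]
    {f : ℝ → E} (hf : IntegrableOn f (Set.Ioi 0)) : Integrable fun x => f |x| := by
  have h1 : IntegrableOn (fun x => f |x|) (Set.Ioi 0) :=
    hf.congr_fun (fun x hx => by rw [abs_of_pos hx]) measurableSet_Ioi
  have h2 : IntegrableOn (fun x => f |x|) (Set.Iic 0) := by
    have := ((integrableOn_Ici_iff_integrableOn_Ioi enorm_ne_top).2 h1).comp_neg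
    simpa using this
  rw [← integrableOn_univ, ← Set.Iic_union_Ioi (a := (0 : ℝ))]
  exact h2.union h1

theorem integral_comp_abs_eq_two_smul {E : Type*} [NormedAddCommGroup E] [NormedSpace ℝ E]
    {f : ℝ → E} (hf : IntegrableOn f (Set.Ioi 0)) :
    ∫ x, f |x| = (2 : ℝ) • ∫ x in Set.Ioi (0 : ℝ), f x := by
  have h1 : ∫ x in Set.Ioi (0 : ℝ), f |x| = ∫ x in Set.Ioi (0 : ℝ), f x :=
    setIntegral_congr_fun measurableSet_Ioi fun x hx => by simp only [abs_of_pos (Set.mem_Ioi.1 hx)]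
  have h2 : ∫ x in Set.Iic (0 : ℝ), f |x| = ∫ x in Set.Ioi (0 : ℝ), f |x| := by
    simpa using (integral_comp_neg_Ioi 0 fun x => f |x|).symm
  rw [← intervalIntegral.integral_Iic_add_Ioi hf.integrable_comp_abs.integrableOn
    hf.integrable_comp_abs.integrableOn, h2, h1, two_smul]

theorem integrable_exp_neg_mul_abs {κ : ℝ} (hκ : 0 < κ) :
    Integrable fun x : ℝ => Real.exp (-(κ * |x|)) := by
  have h := exp_neg_integrableOn_Ioi 0 hκ
  simpa using h.integrable_comp_abs

theorem tendsto_exp_neg_mul_abs {κ : ℝ} (hκ : 0 < κ) {l : Filter ℝ}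
    (hl : Tendsto (fun x : ℝ => |x|) l atTop) :
    Tendsto (fun x : ℝ => Real.exp (-(κ * |x|))) l (𝓝 0) :=
  Real.tendsto_exp_neg_atTop_nhds_zero.comp (hl.const_mul_atTop hκ)

namespace ExpDecayOnStrip

variable {F : ℂ → ℂ} {a b κ : ℝ}

theorem isOpen_strip (a b : ℝ) : IsOpen {ξ : ℂ | a < ξ.re ∧ ξ.re < b} :=
  (isOpen_lt continuous_const Complex.continuous_re).inter
    (isOpen_lt Complex.continuous_re continuous_const)

theorem continuous_vertical (hF : ExpDecayOnStrip F a b κ) {σ : ℝ} (ha : a < σ) (hb : σ < b) :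
    Continuous fun τ : ℝ => F (σ + τ * Complex.I) :=
  hF.differentiableOn.continuousOn.comp_continuous (by fun_prop) fun τ => by simp [ha, hb]

theorem integrable_vertical (hF : ExpDecayOnStrip F a b κ) {σ : ℝ} (ha : a < σ) (hb : σ < b) :
    Integrable fun τ : ℝ => F (σ + τ * Complex.I) := by
  obtain ⟨C, hC⟩ := hF.exists_norm_le σ σ ha hb
  refine ((integrable_exp_neg_mul_abs hF.pos).const_mul C).mono'
    (hF.continuous_vertical ha hb).aestronglyMeasurable (Eventually.of_forall fun τ => ?_)
  simpa using hC (σ + τ * Complex.I) (by simp) (by simp)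

theorem integrable_vertical_cpow (hF : ExpDecayOnStrip F a b κ) {σ : ℝ} (ha : a < σ) (hb : σ < b)
    {x : ℝ} (hx : 0 < x) :
    Integrable fun τ : ℝ => (x : ℂ) ^ (-(σ + τ * Complex.I)) * F (σ + τ * Complex.I) := by
  refine (hF.integrable_vertical ha hb).bdd_mul (c := x ^ (-σ))
    (Continuous.aestronglyMeasurable ?_) (Eventually.of_forall fun τ => ?_)
  · exact Continuous.const_cpow (by fun_prop) (Or.inl (Complex.ofReal_ne_zero.2 hx.ne'))
  · rw [Complex.norm_cpow_eq_rpow_re_of_pos hx]; simp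

theorem norm_mellinInv_le (F : ℂ → ℂ) (σ : ℝ) {x : ℝ} (hx : 0 < x) :
    ‖mellinInv σ F x‖ ≤ (1 / (2 * Real.pi) * ∫ τ : ℝ, ‖F (σ + τ * Complex.I)‖) * x ^ (-σ) := by
  rw [mellinInv, norm_smul, mul_assoc, Real.norm_of_nonneg (by positivity), ← integral_mul_const]
  gcongr
  refine (norm_integral_le_integral_norm _).trans (le_of_eq ?_)
  congr 1; ext τ
  rw [norm_smul, Complex.norm_cpow_eq_rpow_re_of_pos hx, mul_comm]
  simp

theorem mellinInv_eq (hF : ExpDecayOnStrip F a b κ) {σ₁ σ₂ : ℝ} (ha₁ : a < σ₁) (hb₁ : σ₁ < b)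
    (ha₂ : a < σ₂) (hb₂ : σ₂ < b) {x : ℝ} (hx : 0 < x) :
    mellinInv σ₁ F x = mellinInv σ₂ F x := by
  have hx0 : (x : ℂ) ≠ 0 := Complex.ofReal_ne_zero.2 hx.ne'
  have himg : ∀ z : ℂ, (Complex.I * z).re = -z.im := by simp
  have hmem : ∀ y ∈ Set.uIcc (-σ₁) (-σ₂), min σ₁ σ₂ ≤ -y ∧ -y ≤ max σ₁ σ₂ := by
    intro y hy
    rw [Set.mem_uIcc] at hy
    rcases hy with hy | hy
    · exact ⟨(min_le_right _ _).trans (by linarith), le_trans (by linarith) (le_max_left _ _)⟩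
    · exact ⟨(min_le_left _ _).trans (by linarith), le_trans (by linarith) (le_max_right _ _)⟩
  have hmin : a < min σ₁ σ₂ := lt_min ha₁ ha₂
  have hmax : max σ₁ σ₂ < b := max_lt hb₁ hb₂
  obtain ⟨C, hC⟩ := hF.exists_norm_le _ _ hmin hmax
  -- The substitution `ξ = iz` turns the line `Re ξ = σ` into `Im z = -σ`, so that exchanging
  -- horizontal lines applies.
  have hre : ∀ u y : ℝ, Complex.I * (u + y * Complex.I) = ((-y : ℝ) : ℂ) + u * Complex.I := by
    intro u y
    rw [mul_add, mul_left_comm, Complex.I_mul_I]; push_cast; ring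
  have key := integral_horizontal_eq_of_tendsto_zero (a := -σ₁) (b := -σ₂)
    (f := fun z => (x : ℂ) ^ (-(Complex.I * z)) * F (Complex.I * z))
    (g := fun u => (x ^ (-min σ₁ σ₂) + x ^ (-max σ₁ σ₂)) * (C * Real.exp (-(κ * |u|))))
    ?_ ?_ ?_ ?_ ?_ ?_
  · rw [mellinInv, mellinInv]
    simp only [hre, neg_neg] at key
    simp only [smul_eq_mul, key]
  · refine DifferentiableOn.mul ?_ (hF.differentiableOn.comp (by fun_prop) fun z hz => ?_)
    · exact DifferentiableOn.const_cpow (by fun_prop) (Or.inl hx0)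
    · obtain ⟨h1, h2⟩ := hmem _ hz
      rw [Set.mem_ofPred_eq, himg]
      exact ⟨hmin.trans_le h1, h2.trans_lt hmax⟩
  · intro u y hy
    obtain ⟨h1, h2⟩ := hmem _ hy
    simp only [hre]
    rw [norm_mul, Complex.norm_cpow_eq_rpow_re_of_pos hx]
    have e1 : (-(((-y : ℝ) : ℂ) + u * Complex.I)).re = y := by simp
    have e2 := hC (((-y : ℝ) : ℂ) + u * Complex.I) (by simpa using h1) (by simpa using h2)
    have e3 : (((-y : ℝ) : ℂ) + u * Complex.I).im = u := by simp
    rw [e1]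
    rw [e3] at e2
    refine mul_le_mul ?_ e2 (norm_nonneg _) (by positivity)
    rcases le_total 1 x with h | h
    · exact le_add_of_le_of_nonneg (Real.rpow_le_rpow_of_exponent_le h (by linarith))
        (by positivity)
    · exact le_add_of_nonneg_of_le (by positivity)
        (Real.rpow_le_rpow_of_exponent_ge hx h (by linarith))
  · simpa using ((tendsto_exp_neg_mul_abs hF.pos tendsto_abs_atTop_atTop).const_mul C).const_mul _
  · simpa using ((tendsto_exp_neg_mul_abs hF.pos tendsto_abs_atBot_atTop).const_mul C).const_mul _
  · simp only [hre, neg_neg]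
    exact hF.integrable_vertical_cpow ha₁ hb₁ hx
  · simp only [hre, neg_neg]
    exact hF.integrable_vertical_cpow ha₂ hb₂ hx

theorem integrable_fourier_variable (hF : ExpDecayOnStrip F a b κ) {σ : ℝ} (ha : a < σ)
    (hb : σ < b) : Integrable fun y : ℝ => F (σ + 2 * Real.pi * y * Complex.I) := by
  have := (hF.integrable_vertical ha hb).comp_mul_left' (R := 2 * Real.pi) (by positivity)
  simpa using this

theorem continuousOn_mellinInv (hF : ExpDecayOnStrip F a b κ) {σ : ℝ} (ha : a < σ) (hb : σ < b) :
    ContinuousOn (mellinInv σ F) (Set.Ioi 0) := by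
  have hc : Continuous (FourierTransformInv.fourierInv
      fun y : ℝ => F (σ + 2 * Real.pi * y * Complex.I)) := by
    have h : Continuous (FourierTransform.fourier
      fun y : ℝ => F (σ + 2 * Real.pi * y * Complex.I)) :=
      VectorFourier.fourierIntegral_continuous Real.continuous_fourierChar
      (by exact continuous_inner) (hF.integrable_fourier_variable ha hb)
    have e : (FourierTransformInv.fourierInv
      fun y : ℝ => F (σ + 2 * Real.pi * y * Complex.I)) = fun w => FourierTransform.fourier
        (fun y : ℝ => F (σ + 2 * Real.pi * y * Complex.I)) (-w) :=
      funext fun w => Real.fourierInv_eq_fourier_neg _ w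
    rw [e]
    exact h.comp continuous_neg
  refine ContinuousOn.congr (f := fun x : ℝ => (x : ℂ) ^ (-σ : ℂ) •
    FourierTransformInv.fourierInv (fun y : ℝ => F (σ + 2 * Real.pi * y * Complex.I))
      (-Real.log x)) ?_ fun x hx => mellinInv_eq_fourierInv σ F hx
  refine ContinuousOn.smul (M := ℂ) (X := ℂ) ?_ (hc.comp_continuousOn
    (Real.continuousOn_log.mono fun x hx => ne_of_gt hx).neg)
  exact ContinuousOn.cpow_const (by fun_prop) fun x hx => Or.inl (by simpa using hx)

/-- The inverse transform does not depend on the line, and the line `σ'` bounds it by a multiple of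
`x^(-σ')`. A line to the right of `Re s` gives convergence at infinity, one to the left gives it at
`0`. -/
theorem mellinConvergent_mellinInv (hF : ExpDecayOnStrip F a b κ) {σ : ℝ} (ha : a < σ)
    (hb : σ < b) {s : ℂ} (has : a < s.re) (hbs : s.re < b) :
    MellinConvergent (mellinInv σ F) s := by
  have hO : ∀ {l : Filter ℝ} (σ' : ℝ), a < σ' → σ' < b → (∀ᶠ x in l, 0 < x) →
      mellinInv σ F =O[l] fun x : ℝ => x ^ (-σ') := by
    intro l σ' ha' hb' hl
    refine Asymptotics.IsBigO.of_bound
      (1 / (2 * Real.pi) * ∫ τ : ℝ, ‖F (σ' + τ * Complex.I)‖) ?_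
    filter_upwards [hl] with x hx
    rw [hF.mellinInv_eq ha hb ha' hb' hx, Real.norm_of_nonneg (by positivity)]
    exact norm_mellinInv_le F σ' hx
  obtain ⟨σ₁, h1, h1'⟩ := exists_between has
  obtain ⟨σ₂, h2, h2'⟩ := exists_between hbs
  exact mellinConvergent_of_isBigO_rpow
    ((hF.continuousOn_mellinInv ha hb).locallyIntegrableOn measurableSet_Ioi)
    (hO σ₂ (has.trans h2) h2' (eventually_gt_atTop 0)) h2
    (hO σ₁ h1 (h1'.trans hbs) eventually_mem_nhdsWithin) h1'

/-- Mellin inversion: the Mellin transform of the inverse Mellin transform of `F` is `F`. -/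
theorem mellin_mellinInv (hF : ExpDecayOnStrip F a b κ) {σ : ℝ} (ha : a < σ)
    (hb : σ < b) {s : ℂ} (has : a < s.re) (hbs : s.re < b) :
    mellin (mellinInv σ F) s = F s := by
  have h0 : mellin (mellinInv σ F) s = mellin (mellinInv s.re F) s := by
    refine setIntegral_congr_fun measurableSet_Ioi fun x hx => ?_
    simp only [hF.mellinInv_eq ha hb has hbs hx]
  set g := fun y : ℝ => F (s.re + 2 * Real.pi * y * Complex.I) with hg
  have hgc : Continuous g := by
    have := (hF.continuous_vertical has hbs).comp (continuous_const_mul (2 * Real.pi))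
    simpa [Function.comp_def] using this
  have hgi : Integrable g := hF.integrable_fourier_variable has hbs
  have e1 : (fun u : ℝ => Real.exp (-s.re * u) • mellinInv s.re F (Real.exp (-u))) =
      FourierTransformInv.fourierInv g := by
    ext u
    rw [mellinInv_eq_fourierInv _ _ (Real.exp_pos _), Real.log_exp, neg_neg,
      ← Complex.ofReal_neg, ← Complex.ofReal_cpow (Real.exp_pos _).le, ← Real.exp_mul,
      Complex.coe_smul, smul_smul, ← Real.exp_add]
    rw [show -s.re * u + -u * -s.re = 0 by ring, Real.exp_zero, one_smul]
  -- Under `x = exp(-u)` this is the convergence of the Mellin integral at the real point `Re s`. It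
  -- supplies the integrability that Fourier inversion of the continuous function `g` needs.
  have hinv : Integrable (FourierTransformInv.fourierInv g) := by
    have hm := hF.mellinConvergent_mellinInv has hbs (s := (s.re : ℂ)) (by simpa) (by simpa)
    rw [← e1]
    have himg : Real.exp ∘ Neg.neg '' Set.univ = Set.Ioi 0 := by
      rw [Set.image_univ, neg_surjective.range_comp, Real.range_exp]
    have := integrableOn_image_iff_integrableOn_abs_deriv_smul (f := Real.exp ∘ Neg.neg)
      (f' := fun x => -Real.exp (-x))
      (s := Set.univ) MeasurableSet.univ (fun x _ => HasDerivAt.hasDerivWithinAt (by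
        simpa using (Real.hasDerivAt_exp (-x)).comp x (hasDerivAt_neg x)))
      (Real.exp_injective.comp neg_injective).injOn
      (fun t : ℝ => (t : ℂ) ^ ((s.re : ℂ) - 1) • mellinInv s.re F t)
    rw [himg] at this
    refine (integrableOn_univ.1 (this.1 hm)).congr (Eventually.of_forall fun u => ?_)
    have e : ((s.re : ℂ) - 1) = ((s.re - 1 : ℝ) : ℂ) := by simp
    simp only [abs_neg, abs_of_pos (Real.exp_pos _), Function.comp_apply]
    rw [e, ← Complex.ofReal_cpow (Real.exp_pos _).le, ← Real.exp_mul,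
      Complex.coe_smul, smul_smul, ← Real.exp_add]
    congr 2; ring
  have hfou : Integrable (FourierTransform.fourier g) := by
    have := hinv.comp_neg
    refine this.congr (Eventually.of_forall fun w => ?_)
    simp [Real.fourierInv_eq_fourier_neg]
  rw [h0, mellin_eq_fourier, e1, hgc.fourier_fourierInv_eq hgi hfou, hg]
  have hpi : (Real.pi : ℂ) ≠ 0 := Complex.ofReal_ne_zero.2 Real.pi_ne_zero
  conv_rhs => rw [← Complex.re_add_im s]
  simp only
  congr 2
  push_cast
  field_simp

end ExpDecayOnStrip

/-! ### The kernel as a quotient of sines and its holomorphic extension. -/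

theorem Complex.Gamma_neg_mul_Gamma_one_add (w : ℂ) :
    Complex.Gamma (-w) * Complex.Gamma (1 + w) = -(Real.pi / Complex.sin (Real.pi * w)) := by
  have := Complex.Gamma_mul_Gamma_one_sub (-w)
  rwa [sub_neg_eq_add, mul_neg, Complex.sin_neg, div_neg] at this

/-- The reflection formula is applied with `w = ξ/α` above and `w = ξ/2` below. No `ξ` is excluded:
at poles of `Γ` and zeros of the sine the default value `0` appears on both sides of that formula.
-/
theorem Gamma_quotient_eq (α β : ℝ) (ξ : ℂ) :
    (Complex.Gamma (-ξ / α) * Complex.Gamma (1 + ξ) * Complex.Gamma (1 + ξ / α)) /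
      (Complex.Gamma (-ξ / 2) * Complex.Gamma (1 + β * ξ / α) * Complex.Gamma (1 + ξ / 2)) =
    Complex.Gamma (1 + ξ) * (Complex.Gamma (1 + β * ξ / α))⁻¹ *
      (Complex.sin (Real.pi * (ξ / 2)) / Complex.sin (Real.pi * (ξ / α))) := by
  have hpi : (Real.pi : ℂ) ≠ 0 := Complex.ofReal_ne_zero.2 Real.pi_ne_zero
  have h1 := Complex.Gamma_neg_mul_Gamma_one_add (ξ / α)
  have h2 := Complex.Gamma_neg_mul_Gamma_one_add (ξ / 2)
  rw [neg_div, neg_div, mul_right_comm, h1, mul_right_comm (Complex.Gamma (-(ξ / 2))), h2,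
    mul_div_mul_comm, neg_div_neg_eq, div_div_div_cancel_left' _ _ hpi, div_eq_mul_inv]
  ring

theorem foxTheta_fundamental (α β : ℝ) (ξ : ℂ) :
    foxTheta 2 1 (upperParams α β) (lowerParams α) ξ =
    Complex.Gamma (1 + ξ) * (Complex.Gamma (1 + β * ξ / α))⁻¹ *
      (Complex.sin (Real.pi * (ξ / 2)) / Complex.sin (Real.pi * (ξ / α))) := by
  rw [← Gamma_quotient_eq]
  have e1 : (α : ℂ)⁻¹ * ξ = ξ / α := by ring
  have e2 : (2 : ℂ)⁻¹ * ξ = ξ / 2 := by ring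
  have e3 : (β : ℂ) / α * ξ = β * ξ / α := by ring
  simp [foxTheta, Finset.prod_filter, Fin.prod_univ_three, upperParams, lowerParams, e1, e2, e3,
    neg_div]
  ring

theorem exists_nat_mul_of_sin_eq_zero {α : ℝ} (hα : 0 < α) {ξ : ℂ} (hξ : -α < ξ.re)
    (h : Complex.sin (Real.pi * (ξ / α)) = 0) : ∃ k : ℕ, ξ = k * α := by
  obtain ⟨m, hm⟩ := Complex.sin_eq_zero_iff.1 h
  have hpi : (Real.pi : ℂ) ≠ 0 := Complex.ofReal_ne_zero.2 Real.pi_ne_zero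
  have hα' : (α : ℂ) ≠ 0 := Complex.ofReal_ne_zero.2 hα.ne'
  rw [mul_comm, mul_left_inj' hpi, div_eq_iff hα'] at hm
  have hre : ξ.re = m * α := by rw [hm]; simp
  have hm0 : 0 ≤ m := by
    by_contra hneg
    have : (m : ℝ) ≤ -1 := by exact_mod_cast (by omega : m ≤ -1)
    nlinarith
  lift m to ℕ using hm0
  exact ⟨m, by simpa using hm⟩

/-- `q` is the holomorphic extension of `sin(πξ/2) / sin(πξ/α)` to the strip `-α < Re ξ < b`. -/
structure IsSinQuotient (q : ℂ → ℂ) (α b : ℝ) : Prop where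
  differentiableOn : DifferentiableOn ℂ q {ξ | -α < ξ.re ∧ ξ.re < b}
  mul_sin : ∀ ξ : ℂ, -α < ξ.re → ξ.re < b →
    q ξ * Complex.sin (Real.pi * (ξ / α)) = Complex.sin (Real.pi * (ξ / 2))

theorem hasDerivAt_sin_pi_mul_div (c ξ : ℂ) :
    HasDerivAt (fun z : ℂ => Complex.sin (Real.pi * (z / c)))
      (Complex.cos (Real.pi * (ξ / c)) * (Real.pi * (1 / c))) ξ :=
  (((hasDerivAt_id ξ).div_const c).const_mul (Real.pi : ℂ)).csin

/-- In `|Re ξ| < α` the denominator vanishes only at `0`, and simply. Dividing both sines by `ξ`, by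
means of `dslope`, removes this zero. -/
theorem exists_isSinQuotient {α : ℝ} (hα : 0 < α) : ∃ q, IsSinQuotient q α α := by
  have hpi : (Real.pi : ℂ) ≠ 0 := Complex.ofReal_ne_zero.2 Real.pi_ne_zero
  have hα' : (α : ℂ) ≠ 0 := Complex.ofReal_ne_zero.2 hα.ne'
  let f : ℂ → ℂ → ℂ := fun c z => Complex.sin (Real.pi * (z / c))
  have hf : ∀ c, Differentiable ℂ (dslope (f c) 0) := fun c =>
    differentiableOn_univ.1 ((Complex.differentiableOn_dslope univ_mem).2
      fun z _ => (hasDerivAt_sin_pi_mul_div c z).differentiableAt.differentiableWithinAt)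
  have hmul : ∀ c z, z * dslope (f c) 0 z = f c z := by
    intro c z
    have := sub_smul_dslope (f c) 0 z
    simpa [f] using this
  have hne : ∀ z : ℂ, -α < z.re → z.re < α → dslope (f α) 0 z ≠ 0 := by
    intro z h1 h2 h0
    by_cases hz : z = 0
    · rw [hz, dslope_same, (hasDerivAt_sin_pi_mul_div α 0).deriv] at h0
      simp [hpi, hα'] at h0
    · have hs := hmul α z
      rw [h0, mul_zero] at hs
      obtain ⟨k, hk⟩ := exists_nat_mul_of_sin_eq_zero hα h1 hs.symm
      have hre : z.re = k * α := by rw [hk]; simp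
      have hk0 : k = 0 := by
        by_contra hk0
        have : (1 : ℝ) ≤ k := by exact_mod_cast Nat.one_le_iff_ne_zero.2 hk0
        nlinarith
      exact hz (by simp [hk, hk0])
  refine ⟨fun z => dslope (f 2) 0 z / dslope (f α) 0 z,
    (hf 2).differentiableOn.div (hf α).differentiableOn fun z hz => hne z hz.1 hz.2,
    fun z h1 h2 => ?_⟩
  change _ * f α z = f 2 z
  rw [← hmul, ← hmul]
  have := hne z h1 h2
  field_simp

/-- With `φ = πξ/α` the quotient is `sin(kφ)/sin φ = U_{k-1}(cos φ)`, a Chebyshev polynomial of the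
second kind in `cos φ`. It is entire, hence the free right edge `b`. -/
theorem exists_isSinQuotient_of_even {α : ℝ} (hα : 0 < α) {k : ℕ} (hk : α = 2 * k) (b : ℝ) :
    ∃ q, IsSinQuotient q α b := by
  have hk0 : (k : ℂ) ≠ 0 := by
    rintro h
    rw [Nat.cast_eq_zero] at h
    simp [h] at hk
    linarith
  refine ⟨fun z => (Polynomial.Chebyshev.U ℂ (k - 1)).eval (Complex.cos (Real.pi * (z / α))),
    ((Polynomial.differentiable _).comp (f := fun z : ℂ => Complex.cos (Real.pi * (z / α)))
      (by fun_prop)).differentiableOn, fun z _ _ => ?_⟩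
  rw [Polynomial.Chebyshev.U_complex_cos, hk]
  congr 1
  push_cast
  field_simp
  ring

/-- The holomorphic extension of the Mellin-Barnes kernel over its removable singularities. -/
noncomputable def regularTheta (q : ℂ → ℂ) (α β : ℝ) (ξ : ℂ) : ℂ :=
  Complex.Gamma (1 + ξ) * (Complex.Gamma (1 + β * ξ / α))⁻¹ * q ξ

namespace IsSinQuotient

variable {q : ℂ → ℂ} {α b : ℝ}

theorem eq_div (hq : IsSinQuotient q α b) {ξ : ℂ} (h1 : -α < ξ.re) (h2 : ξ.re < b)
    (h0 : Complex.sin (Real.pi * (ξ / α)) ≠ 0) :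
    q ξ = Complex.sin (Real.pi * (ξ / 2)) / Complex.sin (Real.pi * (ξ / α)) := by
  rw [eq_div_iff h0, hq.mul_sin ξ h1 h2]

/-- L'Hôpital's rule: the identity `mul_sin` is differentiated at a zero of the denominator, where
the term containing `q'` drops out. It evaluates `q` at the removable singularities. -/
theorem mul_cos (hq : IsSinQuotient q α b) {ξ : ℂ} (h1 : -α < ξ.re) (h2 : ξ.re < b)
    (h0 : Complex.sin (Real.pi * (ξ / α)) = 0) :
    q ξ * (Complex.cos (Real.pi * (ξ / α)) * (Real.pi * (1 / α))) =
      Complex.cos (Real.pi * (ξ / 2)) * (Real.pi * (1 / 2)) := by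
  have hmem := (ExpDecayOnStrip.isOpen_strip (-α) b).mem_nhds (show ξ ∈ _ from ⟨h1, h2⟩)
  have hd := (hq.differentiableOn.differentiableAt hmem).hasDerivAt.mul
    (hasDerivAt_sin_pi_mul_div α ξ)
  have he := (hasDerivAt_sin_pi_mul_div 2 ξ).congr_of_eventuallyEq
    (f₁ := q * fun z : ℂ => Complex.sin (Real.pi * (z / α)))
    (by filter_upwards [hmem] with z hz using hq.mul_sin z hz.1 hz.2)
  have := hd.unique he
  rwa [h0, mul_zero, zero_add] at this

theorem differentiableOn_regularTheta (hq : IsSinQuotient q α b) (β : ℝ) :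
    DifferentiableOn ℂ (regularTheta q α β) {ξ | max (-1) (-α) < ξ.re ∧ ξ.re < b} := by
  refine DifferentiableOn.mul (DifferentiableOn.mul ?_ ?_)
    (hq.differentiableOn.mono fun ξ hξ => ⟨(le_max_right _ _).trans_lt hξ.1, hξ.2⟩)
  · intro ξ hξ
    refine DifferentiableAt.differentiableWithinAt ?_
    refine (Complex.differentiableAt_Gamma _ fun m hm => ?_).comp ξ (by fun_prop)
    have h1 : (-1 : ℝ) < ξ.re := (le_max_left _ _).trans_lt hξ.1
    have h2 : 1 + ξ.re = -m := by simpa using congrArg Complex.re hm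
    have h3 : (0 : ℝ) ≤ m := Nat.cast_nonneg m
    linarith
  · exact (Complex.differentiable_one_div_Gamma.comp
      (f := fun ξ : ℂ => 1 + β * ξ / α) (by fun_prop)).differentiableOn

/-- Up to `ε`, the exponential rates in `|Im ξ|` are `-π/2` from `Γ(1+ξ)`, `πβ/(2α)` from the
reciprocal Gamma, `π/2` and `-π/α` from the sines. Their sum is at most `-π/(2α)` because `β ≤ 1`.
-/
theorem expDecayOnStrip (hq : IsSinQuotient q α b) (hα : 0 < α) {β : ℝ} (hβ : 0 < β)
    (hβ1 : β ≤ 1) :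
    ExpDecayOnStrip (regularTheta q α β) (max (-1) (-α)) b (Real.pi / (4 * α)) := by
  have hpi := Real.pi_pos
  refine ⟨by positivity, hq.differentiableOn_regularTheta β, fun c d hc hd => ?_⟩
  set κ := Real.pi / (4 * α) with hκ
  have hκ0 : 0 < κ := by positivity
  -- The total loss is at most `ε(1 + 1/α) = π/(4α)`, half of the available rate; the other half is
  -- `κ`.
  set ε := Real.pi / (4 * (α + 1)) with hε
  have hε0 : 0 < ε := by positivity
  have hε1 : ε ≤ Real.pi / 2 := by
    rw [hε, div_le_div_iff₀ (by positivity) two_pos]; nlinarith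
  have hc1 : -1 < c := (le_max_left _ _).trans_lt hc
  have hc2 : -α < c := (le_max_right _ _).trans_lt hc
  obtain ⟨C₁, hC₁, h₁⟩ := Complex.exists_norm_Gamma_le (c := 1 + c) (d := 1 + d)
    (θ := Real.pi / 2 - ε) (by linarith) (by linarith) (by linarith)
  obtain ⟨C₂, hC₂, h₂⟩ := Complex.exists_norm_inv_sin_le (y := Real.pi / α) (by positivity)
  obtain ⟨C₃, hC₃, h₃⟩ := Complex.exists_norm_inv_Gamma_le (y := β / α)
    (θ := Real.pi / 2 - ε) (by positivity) (by linarith) (by linarith)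
    (1 + β / α * c) (1 + β / α * d)
  have hsub : (Set.Icc c d ×ℂ Set.Icc (-1) 1) ⊆ {ξ | max (-1) (-α) < ξ.re ∧ ξ.re < b} :=
    fun ξ hξ => ⟨hc.trans_le hξ.1.1, hξ.1.2.trans_lt hd⟩
  -- The factorwise bounds fail near the real axis, where the sine in the denominator may vanish.
  -- There the holomorphic extension is bounded by compactness, and `exp κ` compensates the decaying
  -- factor for `|Im ξ| ≤ 1`.
  obtain ⟨M, hM⟩ := (isCompact_Icc.reProdIm isCompact_Icc).exists_bound_of_continuousOn
    ((hq.differentiableOn_regularTheta β).continuousOn.mono hsub)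
  refine ⟨C₁ * C₃ * C₂ + |M| * Real.exp κ, fun ξ h1 h2 => ?_⟩
  rw [add_mul]
  rcases le_total |ξ.im| 1 with him | him
  · refine le_add_of_nonneg_of_le (by positivity) ?_
    refine (hM ξ ⟨⟨h1, h2⟩, abs_le.1 him⟩).trans ((le_abs_self M).trans ?_)
    rw [mul_assoc, ← Real.exp_add]
    refine le_mul_of_one_le_right (abs_nonneg _) (Real.one_le_exp ?_)
    nlinarith
  · refine le_add_of_le_of_nonneg ?_ (by positivity)
    have e2 : ((Real.pi : ℂ) * (ξ / α)).im = Real.pi / α * ξ.im := by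
      rw [Complex.im_ofReal_mul, Complex.div_ofReal_im]; ring
    have e2' : ((Real.pi : ℂ) * (ξ / 2)).im = Real.pi / 2 * ξ.im := by
      rw [Complex.im_ofReal_mul, Complex.div_ofNat_im]; ring
    have e3 : (1 + β * ξ / α : ℂ) = 1 + ((β / α : ℝ) : ℂ) * ξ := by push_cast; ring
    have hs : Complex.sin (Real.pi * (ξ / α)) ≠ 0 := fun h0 => by
      obtain ⟨k, hk⟩ := exists_nat_mul_of_sin_eq_zero hα (hc2.trans_le h1) h0
      have : ξ.im = 0 := by rw [hk]; simp
      norm_num [this] at him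
    have b1 := h₁ (1 + ξ) (by simpa using h1) (by simpa using h2)
    have b2 := h₂ (Real.pi * (ξ / α)) (by
      rw [e2, abs_mul, abs_of_pos (by positivity : 0 < Real.pi / α)]
      exact le_mul_of_one_le_right (by positivity) him)
    have b2' := Complex.norm_sin_le_exp (Real.pi * (ξ / 2))
    have b3 := h₃ (1 + β * ξ / α) (by rw [e3]; simpa using by gcongr)
      (by rw [e3]; simpa using by gcongr) (by
        rw [e3]; simp only [Complex.add_im, Complex.one_im, Complex.im_ofReal_mul, zero_add]
        rw [abs_mul, abs_of_pos (by positivity : 0 < β / α)]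
        exact le_mul_of_one_le_right (by positivity) him)
    rw [e2, abs_mul, abs_of_pos (by positivity : 0 < Real.pi / α)] at b2
    rw [e2', abs_mul, abs_of_pos (by positivity : 0 < Real.pi / 2)] at b2'
    have e1i : (1 + ξ).im = ξ.im := by simp
    have e3i : (1 + β * ξ / α : ℂ).im = β / α * ξ.im := by rw [e3]; simp
    rw [e1i] at b1
    rw [e3i, abs_mul, abs_of_pos (by positivity : 0 < β / α)] at b3
    rw [regularTheta, hq.eq_div (by linarith) (by linarith) hs,
      div_eq_mul_inv (Complex.sin _), norm_mul, norm_mul, norm_mul]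
    calc _ ≤ (C₁ * Real.exp (-((Real.pi / 2 - ε) * |ξ.im|))) *
          (C₃ * Real.exp ((Real.pi - (Real.pi / 2 - ε)) * (β / α * |ξ.im|))) *
          (Real.exp (Real.pi / 2 * |ξ.im|) * (C₂ * Real.exp (-(Real.pi / α * |ξ.im|)))) := by
          gcongr
      _ = C₁ * C₃ * C₂ * Real.exp ((ε - Real.pi / α + (Real.pi / 2 + ε) * (β / α)) * |ξ.im|) := by
          rw [show (ε - Real.pi / α + (Real.pi / 2 + ε) * (β / α)) * |ξ.im| =
            -((Real.pi / 2 - ε) * |ξ.im|) + (Real.pi - (Real.pi / 2 - ε)) * (β / α * |ξ.im|) +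
            (Real.pi / 2 * |ξ.im| + -(Real.pi / α * |ξ.im|)) by ring]
          simp only [Real.exp_add]; ring
      _ ≤ _ := by
          rw [← neg_mul]
          have hβα : β / α ≤ 1 / α := by gcongr
          have : ε - Real.pi / α + (Real.pi / 2 + ε) * (1 / α) = -κ := by
            rw [hε, hκ]; field_simp; ring
          have : ε - Real.pi / α + (Real.pi / 2 + ε) * (β / α) ≤ -κ := by
            rw [← this]; gcongr
          gcongr

end IsSinQuotient

/-! ### Moments as Mellin transforms, and their limits. -/

theorem inv_rpow_cpow_neg {A : ℝ} (hA : 0 < A) (α : ℝ) (δ : ℂ) :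
    (((A ^ (1 / α))⁻¹ : ℝ) : ℂ) ^ (-δ) = (A : ℂ) ^ (δ / α) := by
  have hB : 0 < (A ^ (1 / α))⁻¹ := by positivity
  rw [Complex.cpow_def_of_ne_zero (Complex.ofReal_ne_zero.2 hB.ne'),
    Complex.cpow_def_of_ne_zero (Complex.ofReal_ne_zero.2 hA.ne'), ← Complex.ofReal_log hB.le,
    ← Complex.ofReal_log hA.le, Real.log_inv, Real.log_rpow hA]
  congr 1
  push_cast
  ring

theorem momentFormula_eq_of_sin_ne_zero {q : ℂ → ℂ} {α b : ℝ} (hq : IsSinQuotient q α b)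
    (β η t : ℝ) {δ : ℂ} (h1 : -α < δ.re) (h2 : δ.re < b)
    (h0 : Complex.sin (Real.pi * (δ / α)) ≠ 0) :
    momentFormula α β η t δ =
      2 / α * ((η * t ^ β : ℝ) : ℂ) ^ (δ / α) * regularTheta q α β δ := by
  rw [momentFormula, mul_div_assoc, Gamma_quotient_eq, regularTheta, hq.eq_div h1 h2 h0]

theorem eventually_sin_pi_mul_div_ne_zero {α : ℝ} (hα : 0 < α) (δ : ℂ) :
    ∀ᶠ z in 𝓝[≠] δ, Complex.sin (Real.pi * (z / α)) ≠ 0 := by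
  by_cases h : Complex.sin (Real.pi * (δ / α)) = 0
  · refine (hasDerivAt_sin_pi_mul_div α δ).eventually_ne ?_
    have hcos : Complex.cos (Real.pi * (δ / α)) ≠ 0 := by
      intro h'
      have := Complex.sin_sq_add_cos_sq (Real.pi * (δ / α))
      simp [h, h'] at this
    have hpi : (Real.pi : ℂ) ≠ 0 := Complex.ofReal_ne_zero.2 Real.pi_ne_zero
    have hα' : (α : ℂ) ≠ 0 := Complex.ofReal_ne_zero.2 hα.ne'
    exact mul_ne_zero hcos (mul_ne_zero hpi (one_div_ne_zero hα'))
  · exact ((hasDerivAt_sin_pi_mul_div α δ).continuousAt.eventually_ne h).filter_mono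
      nhdsWithin_le_nhds

section Moments

variable {q : ℂ → ℂ} {α b β η t γ : ℝ}

theorem foxTheta_eq_regularTheta (hq : IsSinQuotient q α b) (hα : 0 < α) (β : ℝ) {ξ : ℂ}
    (h1 : -α < ξ.re) (h2 : ξ.re < 0) (h3 : ξ.re < b) :
    foxTheta 2 1 (upperParams α β) (lowerParams α) ξ = regularTheta q α β ξ := by
  have h0 : Complex.sin (Real.pi * (ξ / α)) ≠ 0 := fun h0 => by
    obtain ⟨k, hk⟩ := exists_nat_mul_of_sin_eq_zero hα h1 h0
    have hre : ξ.re = k * α := by rw [hk]; simp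
    have : 0 ≤ k * α := by positivity
    linarith
  rw [foxTheta_fundamental, regularTheta, hq.eq_div h1 h3 h0]

theorem foxIntegrand_eq (hq : IsSinQuotient q α b) (hα : 0 < α) (hb : 0 < b) (β : ℝ)
    (hγ : -α < γ) (hγ0 : γ < 0) (z : ℂ) :
    foxIntegrand γ 2 1 (upperParams α β) (lowerParams α) z = fun τ : ℝ =>
      z ^ (-(γ + τ * Complex.I)) * regularTheta q α β (γ + τ * Complex.I) := by
  ext τ
  rw [foxIntegrand, foxTheta_eq_regularTheta hq hα β (by simpa) (by simpa)
    (by simpa using hγ0.trans hb), mul_comm]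

theorem foxH_eq_mellinInv (hq : IsSinQuotient q α b) (hα : 0 < α) (hb : 0 < b) (β : ℝ)
    (hγ : -α < γ) (hγ0 : γ < 0) (z : ℝ) :
    foxH γ 2 1 (upperParams α β) (lowerParams α) z = mellinInv γ (regularTheta q α β) z := by
  have hI := Complex.I_ne_zero
  have hpi : (Real.pi : ℂ) ≠ 0 := Complex.ofReal_ne_zero.2 Real.pi_ne_zero
  rw [foxH, foxIntegrand_eq hq hα hb β hγ hγ0, mellinInv, ← mul_assoc, ← Complex.coe_smul,
    smul_eq_mul]
  simp only [smul_eq_mul]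
  congr 1
  push_cast
  field_simp

/-- The prefactor `1/(α r)` lowers the exponent to `δ - 1`, so the integral over the half line is
the Mellin transform at `δ` of `H(r/c)/α`. Dilation by `c⁻¹` yields `c^δ = (η t^β)^(δ/α)`, and
evenness doubles the result. -/
theorem integrable_and_fractionalMoment_eq (hq : IsSinQuotient q α b) (hα : 0 < α) (hb : 0 < b)
    (hβ : 0 < β) (hβ1 : β ≤ 1) (hη : 0 < η) (ht : 0 < t) (hγ : max (-1) (-α) < γ) (hγ0 : γ < 0)
    {δ : ℂ} (h1 : max (-1) (-α) < δ.re) (h2 : δ.re < b) :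
    Integrable (fun x : ℝ => ((|x| : ℝ) : ℂ) ^ δ * fundamentalSolution γ α β η t x) ∧
      fractionalMoment γ α β η t δ =
        2 / α * ((η * t ^ β : ℝ) : ℂ) ^ (δ / α) * regularTheta q α β δ := by
  have hF := hq.expDecayOnStrip hα hβ hβ1
  have hγα : -α < γ := (le_max_right _ _).trans_lt hγ
  have hα' : (α : ℂ) ≠ 0 := Complex.ofReal_ne_zero.2 hα.ne'
  have hA : 0 < η * t ^ β := by positivity
  set c := (η * t ^ β) ^ (1 / α) with hc
  have hc0 : 0 < c⁻¹ := by positivity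
  let G : ℝ → ℂ := fun r => (1 / α : ℂ) • mellinInv γ (regularTheta q α β) (c⁻¹ * r)
  have hG : MellinConvergent G δ :=
    ((MellinConvergent.comp_mul_left hc0).2
      (hF.mellinConvergent_mellinInv hγ (hγ0.trans hb) h1 h2)).const_smul (1 / α : ℂ)
  have hGm : mellin G δ = 1 / α * (((η * t ^ β : ℝ) : ℂ) ^ (δ / α) * regularTheta q α β δ) := by
    rw [mellin_const_smul, mellin_comp_mul_left _ _ hc0,
      hF.mellin_mellinInv hγ (hγ0.trans hb) h1 h2, hc, inv_rpow_cpow_neg hA, smul_eq_mul,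
      smul_eq_mul]
  let f : ℝ → ℂ := fun r => (r : ℂ) ^ δ * (1 / (α * r : ℝ) *
    foxH γ 2 1 (upperParams α β) (lowerParams α) ((r / c : ℝ) : ℂ))
  have hfG : Set.EqOn (fun r : ℝ => (r : ℂ) ^ (δ - 1) • G r) f (Set.Ioi 0) := by
    intro r hr
    have hr' : (r : ℂ) ≠ 0 := Complex.ofReal_ne_zero.2 (ne_of_gt hr)
    simp only [f, G, smul_eq_mul]
    rw [foxH_eq_mellinInv hq hα hb β hγα hγ0, Complex.cpow_sub _ _ hr', Complex.cpow_one,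
      inv_mul_eq_div]
    push_cast
    field_simp
  have hf : IntegrableOn f (Set.Ioi 0) := hG.congr_fun hfG measurableSet_Ioi
  have hfun : (fun x : ℝ => ((|x| : ℝ) : ℂ) ^ δ * fundamentalSolution γ α β η t x) =
      fun x => f |x| := rfl
  rw [fractionalMoment, hfun]
  refine ⟨hf.integrable_comp_abs, ?_⟩
  rw [integral_comp_abs_eq_two_smul hf, ← setIntegral_congr_fun measurableSet_Ioi hfG]
  change (2 : ℝ) • mellin G δ = _
  rw [hGm, Complex.real_smul]
  push_cast
  ring

theorem continuousAt_cpow_mul_regularTheta (hq : IsSinQuotient q α b) (hη : 0 < η) (ht : 0 < t)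
    {δ : ℂ} (h1 : max (-1) (-α) < δ.re) (h2 : δ.re < b) :
    ContinuousAt (fun δ : ℂ => 2 / α * ((η * t ^ β : ℝ) : ℂ) ^ (δ / α) * regularTheta q α β δ)
      δ := by
  have hA : 0 < η * t ^ β := by positivity
  refine ContinuousAt.mul (continuousAt_const.mul ?_) ((hq.differentiableOn_regularTheta
    β).continuousOn.continuousAt ((ExpDecayOnStrip.isOpen_strip _ _).mem_nhds ⟨h1, h2⟩))
  exact ContinuousAt.const_cpow (by fun_prop) (Or.inl (Complex.ofReal_ne_zero.2 hA.ne'))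

theorem tendsto_momentFormula (hq : IsSinQuotient q α b) (hα : 0 < α) (hη : 0 < η) (ht : 0 < t)
    {δ : ℂ} (h1 : max (-1) (-α) < δ.re) (h2 : δ.re < b) :
    Tendsto (momentFormula α β η t) (𝓝[≠] δ)
      (𝓝 (2 / α * ((η * t ^ β : ℝ) : ℂ) ^ (δ / α) * regularTheta q α β δ)) := by
  refine ((continuousAt_cpow_mul_regularTheta hq hη ht h1 h2).tendsto.mono_left
    nhdsWithin_le_nhds).congr' ?_
  filter_upwards [eventually_sin_pi_mul_div_ne_zero hα δ, nhdsWithin_le_nhds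
    ((ExpDecayOnStrip.isOpen_strip _ _).mem_nhds ⟨h1, h2⟩)] with z hz hz'
  exact (momentFormula_eq_of_sin_ne_zero hq β η t ((le_max_right _ _).trans_lt hz'.1) hz'.2
    hz).symm

theorem tendsto_fractionalMoment (hq : IsSinQuotient q α b) (hα : 0 < α) (hb : 0 < b)
    (hβ : 0 < β) (hβ1 : β ≤ 1) (hη : 0 < η) (ht : 0 < t) (hγ : max (-1) (-α) < γ) (hγ0 : γ < 0)
    {δ : ℂ} (h1 : max (-1) (-α) < δ.re) (h2 : δ.re < b) :
    Tendsto (fractionalMoment γ α β η t) (𝓝 δ)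
      (𝓝 (2 / α * ((η * t ^ β : ℝ) : ℂ) ^ (δ / α) * regularTheta q α β δ)) := by
  refine (continuousAt_cpow_mul_regularTheta hq hη ht h1 h2).tendsto.congr' ?_
  filter_upwards [(ExpDecayOnStrip.isOpen_strip _ _).mem_nhds ⟨h1, h2⟩] with z hz
  exact (integrable_and_fractionalMoment_eq hq hα hb hβ hβ1 hη ht hγ hγ0 hz.1 hz.2).2.symm

end Moments

theorem mainTheorem4 (α β η t γ : ℝ) (hα : 0 < α) (hβ : 0 < β) (hβ1 : β ≤ 1)
    (hη : 0 < η) (ht : 0 < t)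
    (hγ : SeparatesPoles γ 2 1 (upperParams α β) (lowerParams α)) :
    -- the Mellin-Barnes integral defining the Fox function converges absolutely
    (∀ z : ℝ, 0 < z →
      Integrable (foxIntegrand γ 2 1 (upperParams α β) (lowerParams α) (z : ℂ))) ∧
    -- the moments of order `δ`; at the removable singularities `δ = kα` of the closed form, its
    -- value is understood by continuity
    (∀ δ : ℂ, -1 < δ.re → 0 < (δ + α).re → (δ.re < α ∨ ∃ k : ℕ, α = 2 * k) →
      Integrable (fun x : ℝ => ((|x| : ℝ) : ℂ) ^ δ * fundamentalSolution γ α β η t x) ∧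
      ((∀ k : ℕ, δ ≠ k * α) →
        fractionalMoment γ α β η t δ = momentFormula α β η t δ) ∧
      Tendsto (momentFormula α β η t) (𝓝[≠] δ) (𝓝 (fractionalMoment γ α β η t δ))) ∧
    -- the limit `δ → 0`
    Tendsto (fractionalMoment γ α β η t) (𝓝 0) (𝓝 1) ∧
    -- the case `α = 2`, `δ → 2`
    (α = 2 →
      fractionalMoment γ α β η t 2 = ((2 * η * t ^ β / Real.Gamma (1 + β) : ℝ) : ℂ) ∧
      Tendsto (fractionalMoment γ α β η t) (𝓝 2)
        (𝓝 ((2 * η * t ^ β / Real.Gamma (1 + β) : ℝ) : ℂ))) := by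
  obtain ⟨hγ1, hγα, hγ0⟩ := (separatesPoles_iff γ α β hα).1 hγ
  have hγm : max (-1) (-α) < γ := max_lt hγ1 hγα
  have hpi : (Real.pi : ℂ) ≠ 0 := Complex.ofReal_ne_zero.2 Real.pi_ne_zero
  have hα' : (α : ℂ) ≠ 0 := Complex.ofReal_ne_zero.2 hα.ne'
  have hm0 : max (-1) (-α) < (0 : ℂ).re := by simpa using hα
  refine ⟨fun z hz => ?_, fun δ h1 h2 h3 => ?_, ?_, fun hα2 => ?_⟩
  · obtain ⟨q, hq⟩ := exists_isSinQuotient hα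
    rw [foxIntegrand_eq hq hα hα β hγα hγ0]
    exact (hq.expDecayOnStrip hα hβ hβ1).integrable_vertical_cpow hγm (hγ0.trans hα) hz
  · have h2' : -α < δ.re := by
      rw [Complex.add_re, Complex.ofReal_re] at h2
      linarith
    obtain ⟨b, q, hb, hδb, hq⟩ : ∃ (b : ℝ) (q : ℂ → ℂ), 0 < b ∧ δ.re < b ∧
        IsSinQuotient q α b := by
      rcases h3 with h3 | ⟨k, hk⟩
      · obtain ⟨q, hq⟩ := exists_isSinQuotient hα
        exact ⟨α, q, hα, h3, hq⟩
      · obtain ⟨q, hq⟩ := exists_isSinQuotient_of_even hα hk (|δ.re| + 1)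
        -- For even `α` any right edge is allowed; `|Re δ| + 1` is positive and lies beyond `Re δ`.
        exact ⟨_, q, by positivity, by linarith [le_abs_self δ.re], hq⟩
    obtain ⟨hint, hmom⟩ := integrable_and_fractionalMoment_eq hq hα hb hβ hβ1 hη ht hγm hγ0
      (max_lt h1 h2') hδb
    refine ⟨hint, fun hk => ?_, ?_⟩
    · rw [hmom, momentFormula_eq_of_sin_ne_zero hq β η t h2' hδb fun h0 => ?_]
      obtain ⟨k, hk'⟩ := exists_nat_mul_of_sin_eq_zero hα h2' h0
      exact hk k hk'
    · rw [hmom]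
      exact tendsto_momentFormula hq hα hη ht (max_lt h1 h2') hδb
  · obtain ⟨q, hq⟩ := exists_isSinQuotient hα
    -- The full neighbourhood filter contains the point `0` itself, so this limit also fixes the
    -- moment of order `0`.
    have hlim := tendsto_fractionalMoment hq hα hα hβ hβ1 hη ht hγm hγ0 hm0 (by simpa)
    have hq0 := hq.mul_cos (ξ := 0) (by simpa) (by simpa) (by simp)
    have hval : q 0 = α / 2 := by
      simp only [zero_div, mul_zero, Complex.cos_zero, one_mul] at hq0
      field_simp at hq0 ⊢
      linear_combination hq0
    convert hlim using 2
    simp [regularTheta, hval]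
    field_simp
  · subst hα2
    -- The order `2 = α` lies on the edge of the strip of the general quotient, so the entire one is
    -- used; the edge `3` is any number above `2`.
    obtain ⟨q, hq⟩ := exists_isSinQuotient_of_even (k := 1) hα (by norm_num) 3
    have hm2 : max (-1) (-2) < (2 : ℂ).re := by norm_num
    have h23 : (2 : ℂ).re < 3 := by norm_num
    have hq2 := hq.mul_cos (ξ := 2) (by norm_num) h23 (by simp)
    have hval : q 2 = 1 := by
      simp at hq2
      field_simp at hq2
      exact hq2
    have hG3 : Complex.Gamma (1 + 2) = 2 := by
      have := Complex.Gamma_nat_eq_factorial 2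
      norm_num at this ⊢
    have hv : 2 / ((2 : ℝ) : ℂ) * ((η * t ^ β : ℝ) : ℂ) ^ ((2 : ℂ) / ((2 : ℝ) : ℂ)) *
        regularTheta q 2 β 2 = ((2 * η * t ^ β / Real.Gamma (1 + β) : ℝ) : ℂ) := by
      rw [regularTheta, hval, hG3]
      have e : (1 + β * 2 / ((2 : ℝ) : ℂ) : ℂ) = ((1 + β : ℝ) : ℂ) := by push_cast; ring
      rw [e, Complex.Gamma_ofReal]
      push_cast
      rw [div_self two_ne_zero, Complex.cpow_one]
      ring
    rw [← hv]
    exact ⟨(integrable_and_fractionalMoment_eq hq hα three_pos hβ hβ1 hη ht hγm hγ0 hm2 h23).2,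
      tendsto_fractionalMoment hq hα three_pos hβ hβ1 hη ht hγm hγ0 hm2 h23⟩
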